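/- Let $\mathsf{Prop}$ be a set of propositional variables. **Syntax.** Classical formulas are given by $\alpha ::= p\mid\bot\mid\top\mid\neg\alpha\mid\alpha\wedge\alpha\mid\alpha\vee\alpha$ with $p\in\mathsf{Prop}$. A primitive inclusion atom is $\mathsf x\subseteq\mathsf a$, where $\mathsf x=x_1\dots x_n$ and $\mathsf a=a_1\dots a_n$ ($n\ge 0$), $x_i\in\{\top,\bot\}$ and $a_i\in\mathsf{Prop}\cup\{\top,\bot\}$. Formulas of $\mathbf{CPL}(\subseteq_0)$ are given by $\phi ::= p\mid\bot\mid\top\mid\neg\alpha\mid\phi\wedge\phi\mid\phi\vee\phi\mid\mathsf x\subseteq\mathsf a$, with $\alpha$ classical. **Semantics.** A team with domain $\mathsf N\subseteq\mathsf{Prop}$ ($\mathsf N$ possibly infinite) is a set $X$ of valuations $v:\mathsf N\to\{0,1\}$, extended by $v(\bot)=0$, $v(\top)=1$. For a formula whose variables lie in $\mathsf N$: - $X\models p$ iff $v(p)=1$ for all $v\in X$; $X\models\bot$ iff $X=\emptyset$; $X\models\top$ always; - $X\models\neg\alpha$ iff $\{v\}\not\models\alpha$ for all $v\in X$; - $X\models\phi\wedge\psi$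 iff $X\models\phi$ and $X\models\psi$; - $X\models\phi\vee\psi$ iff $X=Y\cup Z$ for some $Y\models\phi$ and $Z\models\psi$; - $X\models\mathsf x\subseteq\mathsf a$ iff for every $v\in X$ there is $u\in X$ with $v(x_i)=u(a_i)$ for all $i$. $\Gamma\models\phi$ means: every team $X$ whose domain contains all variables of $\Gamma\cup\{\phi\}$ and which satisfies all formulas of $\Gamma$ satisfies $\phi$. **Natural deduction.** Below all formulas are formulas of $\mathbf{CPL}(\subseteq_0)$ (so all inclusion atoms are primitive), $\alpha$ is classical, and juxtaposition of sequences is concatenation, where sequences at corresponding places on the two sides of $\subseteq$ have equal length. Put $p^\top=p$, $p^\bot=\neg p$, $\top^\top=\bot^\bot=\top$, $\top^\bot=\bot^\top=\bot$ and $\mathsf a^{\mathsf x}=a_1^{x_1}\wedge\dots\wedge a_n^{x_n}$ (which is $\top$ if $n=0$). The rules are: - $\top\mathsf I$: $\top$ is derivable without premises. - $\neg\mathsf I$: from a derivation of $\bot$ infer $\neg\alpha$, discharging $\alpha$; RAA: from a derivation of $\bot$ infer $\alpha$, discharging $\neg\alpha$. In both, all undischarged assumptions of the derivation of $\bot$ (apart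 from the discharged formula) must be classical. - $\neg\mathsf E$: from $\alpha$ and $\neg\alpha$ infer any $\phi$. - $\wedge\mathsf I$, $\wedge\mathsf E$, $\vee\mathsf I$: the usual rules. - $\vee\mathsf E$: from $\phi\vee\psi$, a derivation of $\chi$ (discharging $\phi$) and a derivation of $\chi$ (discharging $\psi$) infer $\chi$, provided that all other undischarged assumptions of the latter two derivations are classical. - From $\mathsf{abc}\subseteq\mathsf{a'b'c'}$ infer $\mathsf{bac}\subseteq\mathsf{b'a'c'}$; from $\mathsf{ab}\subseteq\mathsf{cd}$ infer $\mathsf a\subseteq\mathsf c$; from $\mathsf{ab}\subseteq\mathsf{cd}$ infer $\mathsf{aab}\subseteq\mathsf{ccd}$; from $\mathsf a\subseteq\mathsf b$ and $\mathsf b\subseteq\mathsf c$ infer $\mathsf a\subseteq\mathsf c$; $\mathsf a\subseteq\mathsf a$ without premises. - $\subseteq$Cmp: from $\mathsf a\subseteq\mathsf b$ and $\alpha(\mathsf b)$ infer $\alpha(\mathsf a)$, where all variables and constants occurring in $\alpha(\mathsf b)$ are entries of $\mathsf b$, and $\alpha(\mathsf a)$ is obtained by replacing each occurrence, regarded as an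 entry $b_i$ of $\mathsf b$, by $a_i$. - $\subseteq_0$Ext: from $\mathsf a\subseteq\mathsf b$ infer $\top\mathsf a\subseteq\top\mathsf b$ and $\bot\mathsf a\subseteq\bot\mathsf b$; from $p$ and $\mathsf a\subseteq\mathsf b$ infer $\top\mathsf a\subseteq p\mathsf b$; from $\neg p$ and $\mathsf a\subseteq\mathsf b$ infer $\bot\mathsf a\subseteq p\mathsf b$. - $\vee_{\subseteq_0}\mathsf E$: from $(\phi\wedge\mathsf x\subseteq\mathsf a)\vee\psi$ and derivations of $\chi$ discharging respectively $\{\phi,\ \mathsf x\subseteq\mathsf a\}$, $\{\psi\}$, and $\{\phi\vee\psi,\ \mathsf x\subseteq\mathsf a\}$, infer $\chi$ (no side condition). - $\subseteq_0$Dst: from $\phi\vee\psi$ and $\mathsf x_1\subseteq\mathsf a_1,\dots,\mathsf x_k\subseteq\mathsf a_k$ infer $\big((\phi\vee\mathsf a_1^{\mathsf x_1}\vee\dots\vee\mathsf a_k^{\mathsf x_k})\wedge\mathsf x_1\subseteq\mathsf a_1\wedge\dots\wedge\mathsf x_k\subseteq\mathsf a_k\big)\vee\psi$. $\Gamma\vdash\phi$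 means that there is a derivation of $\phi$ all of whose undischarged assumptions belong to $\Gamma$. **Theorem (soundness and completeness).** For every set $\Gamma\cup\{\phi\}$ of $\mathbf{CPL}(\subseteq_0)$-formulas, $\Gamma\models\phi$ if and only if $\Gamma\vdash\phi$. -/

import Mathlib

namespace PInc

universe u

/-- Formulas of classical propositional logic CPL over the set `V` of propositional variables. -/
inductive Cl (V : Type u) : Type u
  | var (p : V) : Cl V
  | bot : Cl V
  | top : Cl V
  | neg (α : Cl V) : Cl V
  | and (α β : Cl V) : Cl V
  | or (α β : Cl V) : Cl V

/-- The possible arguments of an inclusion atom: propositional variables and the two constants;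
`const true` is `⊤` and `const false` is `⊥`. -/
inductive Arg (V : Type u) : Type u
  | var (p : V) : Arg V
  | const (b : Bool) : Arg V

/-- Formulas of CPL(⊆₀). Negation is applied to classical formulas only. The primitive inclusion
atom `x₁…xₙ ⊆ a₁…aₙ` (`xᵢ ∈ {⊤,⊥}`, `aᵢ` a variable or a constant, `n ≥ 0`) is `incl l`, where
`l = [(x₁,a₁), …, (xₙ,aₙ)]` and the constants `⊤`, `⊥` on the left are written `true`, `false`. -/
inductive Fm (V : Type u) : Type u
  | var (p : V) : Fm V
  | bot : Fm V
  | top : Fm V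
  | neg (α : Cl V) : Fm V
  | and (φ ψ : Fm V) : Fm V
  | or (φ ψ : Fm V) : Fm V
  | incl (l : List (Bool × Arg V)) : Fm V

variable {V : Type u}

/-- A classical formula, seen as a formula of CPL(⊆₀). -/
def Cl.toFm : Cl V → Fm V
  | .var p => .var p
  | .bot => .bot
  | .top => .top
  | .neg α => .neg α
  | .and α β => .and α.toFm β.toFm
  | .or α β => .or α.toFm β.toFm

def Fm.IsClassical (φ : Fm V) : Prop := ∃ α : Cl V, α.toFm = φ

/-- The propositional variables that occur in a formula. -/
def Cl.vars : Cl V → Set V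
  | .var p => {p}
  | .bot => ∅
  | .top => ∅
  | .neg α => α.vars
  | .and α β => α.vars ∪ β.vars
  | .or α β => α.vars ∪ β.vars

def Fm.vars : Fm V → Set V
  | .var p => {p}
  | .bot => ∅
  | .top => ∅
  | .neg α => α.vars
  | .and φ ψ => φ.vars ∪ ψ.vars
  | .or φ ψ => φ.vars ∪ ψ.vars
  | .incl l => {p | ∃ x : Bool, (x, Arg.var p) ∈ l}

/-! ### Team semantics -/

section Semantics

variable {N : Set V}

open Classical in
/-- The value of the variable `p` under a valuation with domain `N`. The value `false` outside of
`N` is a dummy: entailment looks only at teams whose domain contains all the variables involved. -/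
noncomputable def val (v : N → Bool) (p : V) : Bool :=
  if h : p ∈ N then v ⟨p, h⟩ else false

noncomputable def argVal (v : N → Bool) : Arg V → Bool
  | .var p => val v p
  | .const b => b

/-- Truth of a classical formula on a team `X` with domain `N`. -/
def Cl.Sat : Cl V → Set (N → Bool) → Prop
  | .var p, X => ∀ v ∈ X, val v p = true
  | .bot, X => X = ∅
  | .top, _ => True
  | .neg α, X => ∀ v ∈ X, ¬ α.Sat {v}
  | .and α β, X => α.Sat X ∧ β.Sat X
  | .or α β, X => ∃ Y Z : Set (N → Bool), X = Y ∪ Z ∧ α.Sat Y ∧ β.Sat Z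

/-- Truth of a CPL(⊆₀)-formula on a team `X` with domain `N`. -/
def Fm.Sat : Fm V → Set (N → Bool) → Prop
  | .var p, X => ∀ v ∈ X, val v p = true
  | .bot, X => X = ∅
  | .top, _ => True
  | .neg α, X => ∀ v ∈ X, ¬ α.Sat {v}
  | .and φ ψ, X => φ.Sat X ∧ ψ.Sat X
  | .or φ ψ, X => ∃ Y Z : Set (N → Bool), X = Y ∪ Z ∧ φ.Sat Y ∧ ψ.Sat Z
  | .incl l, X => ∀ v ∈ X, ∃ u ∈ X, ∀ e ∈ l, argVal v (.const e.1) = argVal u e.2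

end Semantics

/-- `Γ ⊨ φ`: every team whose domain contains the variables of `Γ` and `φ`, and on which all
formulas of `Γ` are true, makes `φ` true. Domains are arbitrary sets of variables. -/
def Entails (Γ : Set (Fm V)) (φ : Fm V) : Prop :=
  ∀ N : Set V, (∀ γ ∈ Γ, γ.vars ⊆ N) → φ.vars ⊆ N →
    ∀ X : Set (N → Bool), (∀ γ ∈ Γ, γ.Sat X) → φ.Sat X

/-! ### Syntactic operations used by the rules -/

def constCl (b : Bool) : Cl V := if b then .top else .bot

def Arg.toCl : Arg V → Cl V
  | .var p => .var p
  | .const b => constCl b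

/-- `a^x`: `p^⊤ = p`, `p^⊥ = ¬p`, and for constants `⊤^⊤ = ⊥^⊥ = ⊤`, `⊤^⊥ = ⊥^⊤ = ⊥`. -/
def lit : Bool × Arg V → Cl V
  | (true, .var p) => .var p
  | (false, .var p) => .neg (.var p)
  | (x, .const b) => constCl (x == b)

/-- `a₁^x₁ ∧ … ∧ aₙ^xₙ`; the empty conjunction is `⊤`. -/
def lits : List (Bool × Arg V) → Cl V
  | [] => .top
  | [e] => lit e
  | e :: e' :: l => .and (lit e) (lits (e' :: l))

/-- Replacement of the variables of a classical formula by classical formulas. -/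
def Cl.subst {W : Type*} (σ : W → Cl V) : Cl W → Cl V
  | .var i => σ i
  | .bot => .bot
  | .top => .top
  | .neg α => .neg (α.subst σ)
  | .and α β => .and (α.subst σ) (β.subst σ)
  | .or α β => .or (α.subst σ) (β.subst σ)

/-- No constant `⊤`, `⊥` occurs in the formula. -/
def Cl.ConstFree {W : Type*} : Cl W → Prop
  | .var _ => True
  | .bot => False
  | .top => False
  | .neg α => α.ConstFree
  | .and α β => α.ConstFree ∧ β.ConstFree
  | .or α β => α.ConstFree ∧ β.ConstFree

/-- `φ ∨ a₁^x₁ ∨ … ∨ a_k^x_k` -/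
def orLits (φ : Fm V) (ls : List (List (Bool × Arg V))) : Fm V :=
  ls.foldl (fun χ l => .or χ (lits l).toFm) φ

/-- `φ ∧ x₁ ⊆ a₁ ∧ … ∧ x_k ⊆ a_k` (each `xᵢ ⊆ aᵢ` an inclusion atom) -/
def andIncls (φ : Fm V) (ls : List (List (Bool × Arg V))) : Fm V :=
  ls.foldl (fun χ l => .and χ (.incl l)) φ

/-! ### Natural deduction -/

/-- `Deriv A φ`: there is a natural deduction derivation in the system of CPL(⊆₀) with conclusion
`φ` whose set of undischarged assumptions is `A`. -/
inductive Deriv : Set (Fm V) → Fm V → Prop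
  | hyp (φ : Fm V) : Deriv {φ} φ
  | topI : Deriv ∅ .top
  | negI {A : Set (Fm V)} {α : Cl V} :
      Deriv A .bot → (∀ γ ∈ A \ {α.toFm}, γ.IsClassical) → Deriv (A \ {α.toFm}) (.neg α)
  | negE {A B : Set (Fm V)} {α : Cl V} (φ : Fm V) :
      Deriv A α.toFm → Deriv B (.neg α) → Deriv (A ∪ B) φ
  /-- reductio ad absurdum -/
  | raa {A : Set (Fm V)} {α : Cl V} :
      Deriv A .bot → (∀ γ ∈ A \ {.neg α}, γ.IsClassical) → Deriv (A \ {.neg α}) α.toFm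
  | andI {A B : Set (Fm V)} {φ ψ : Fm V} :
      Deriv A φ → Deriv B ψ → Deriv (A ∪ B) (.and φ ψ)
  | andE₁ {A : Set (Fm V)} {φ ψ : Fm V} : Deriv A (.and φ ψ) → Deriv A φ
  | andE₂ {A : Set (Fm V)} {φ ψ : Fm V} : Deriv A (.and φ ψ) → Deriv A ψ
  | orI₁ {A : Set (Fm V)} {φ : Fm V} (ψ : Fm V) : Deriv A φ → Deriv A (.or φ ψ)
  | orI₂ {A : Set (Fm V)} {φ : Fm V} (ψ : Fm V) : Deriv A φ → Deriv A (.or ψ φ)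
  | orE {A B C : Set (Fm V)} {φ ψ χ : Fm V} :
      Deriv A (.or φ ψ) →
      Deriv B χ → (∀ γ ∈ B \ {φ}, γ.IsClassical) →
      Deriv C χ → (∀ γ ∈ C \ {ψ}, γ.IsClassical) →
      Deriv (A ∪ B \ {φ} ∪ C \ {ψ}) χ
  /-- exchange: from `abc ⊆ a'b'c'` infer `bac ⊆ b'a'c'` -/
  | inclExc {A : Set (Fm V)} {a b c : List (Bool × Arg V)} :
      Deriv A (.incl (a ++ b ++ c)) → Deriv A (.incl (b ++ a ++ c))
  /-- contraction: from `ab ⊆ cd` infer `a ⊆ c` -/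
  | inclCtr {A : Set (Fm V)} {a b : List (Bool × Arg V)} :
      Deriv A (.incl (a ++ b)) → Deriv A (.incl a)
  /-- weakening: from `ab ⊆ cd` infer `aab ⊆ ccd` -/
  | inclWk {A : Set (Fm V)} {a b : List (Bool × Arg V)} :
      Deriv A (.incl (a ++ b)) → Deriv A (.incl (a ++ a ++ b))
  /-- transitivity: from `a ⊆ b` and `b ⊆ c` infer `a ⊆ c`; the sequences `a`, `b` consist of
  constants since all atoms are primitive, and `t` lists the triples `(aᵢ, bᵢ, cᵢ)` -/
  | inclTrs {A B : Set (Fm V)} (t : List (Bool × Bool × Arg V)) :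
      Deriv A (.incl (t.map fun e => (e.1, .const e.2.1))) →
      Deriv B (.incl (t.map fun e => (e.2.1, e.2.2))) →
      Deriv (A ∪ B) (.incl (t.map fun e => (e.1, e.2.2)))
  /-- identity: `a ⊆ a`, where `a` consists of constants since all atoms are primitive -/
  | inclId (a : List Bool) : Deriv ∅ (.incl (a.map fun x => (x, .const x)))
  /-- compression: from `a ⊆ b` and `α(b)` infer `α(a)`. The classical formula `α` is given with
  one place for each position of the sequences, filled with `bᵢ` in `α(b)` and with `aᵢ` in `α(a)`;
  all variables and constants that occur in `α(b)` come from `b`. -/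
  | inclCmp {A B : Set (Fm V)} (l : List (Bool × Arg V)) (α : Cl (Fin l.length)) :
      α.ConstFree → Deriv A (.incl l) →
      Deriv B (α.subst fun i => (l.get i).2.toCl).toFm →
      Deriv (A ∪ B) (α.subst fun i => constCl (l.get i).1).toFm
  /-- from `a ⊆ b` infer `⊤a ⊆ ⊤b` and `⊥a ⊆ ⊥b` -/
  | inclExtConst {A : Set (Fm V)} {l : List (Bool × Arg V)} (x : Bool) :
      Deriv A (.incl l) → Deriv A (.incl ((x, .const x) :: l))
  /-- from `p` and `a ⊆ b` infer `⊤a ⊆ pb` -/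
  | inclExtPos {A B : Set (Fm V)} {l : List (Bool × Arg V)} {p : V} :
      Deriv A (.var p) → Deriv B (.incl l) → Deriv (A ∪ B) (.incl ((true, .var p) :: l))
  /-- from `¬p` and `a ⊆ b` infer `⊥a ⊆ pb` -/
  | inclExtNeg {A B : Set (Fm V)} {l : List (Bool × Arg V)} {p : V} :
      Deriv A (.neg (.var p)) → Deriv B (.incl l) → Deriv (A ∪ B) (.incl ((false, .var p) :: l))
  /-- elimination of `(φ ∧ x ⊆ a) ∨ ψ`, without side condition -/
  | orInclE {A B C D : Set (Fm V)} {φ ψ χ : Fm V} {l : List (Bool × Arg V)} :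
      Deriv A (.or (.and φ (.incl l)) ψ) →
      Deriv B χ → Deriv C χ → Deriv D χ →
      Deriv (A ∪ B \ {φ, .incl l} ∪ C \ {ψ} ∪ D \ {.or φ ψ, .incl l}) χ
  /-- distribution: from `φ ∨ ψ` and `x₁ ⊆ a₁`, …, `x_k ⊆ a_k` infer
  `((φ ∨ a₁^x₁ ∨ … ∨ a_k^x_k) ∧ x₁ ⊆ a₁ ∧ … ∧ x_k ⊆ a_k) ∨ ψ` -/
  | inclDst {A : Set (Fm V)} {φ ψ : Fm V} (ls : List (List (Bool × Arg V)))
      (B : Fin ls.length → Set (Fm V)) :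
      Deriv A (.or φ ψ) → (∀ i, Deriv (B i) (.incl (ls.get i))) →
      Deriv (A ∪ ⋃ i, B i) (.or (andIncls (orLits φ ls) ls) ψ)

/-- `Γ ⊢ φ`: there is a derivation of `φ` whose undischarged assumptions all belong to `Γ`. -/
def Provable (Γ : Set (Fm V)) (φ : Fm V) : Prop := ∃ A ⊆ Γ, Deriv A φ

end PInc

/-! Soundness is an induction on derivations. Its semantic inputs are that classical formulas are
flat (`Cl.sat_iff_eval`), that all formulas are closed under unions (`Fm.sat_sUnion`), and that a
primitive atom on a nonempty team merely asserts that one valuation with prescribed values exists.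

Completeness is a Lindenbaum argument. An unprovable `φ` is avoided by a maximal theory `Δ ⊇ Γ`, and
the canonical team consists of all valuations satisfying the classical part of `Δ`. The truth lemma
`truthful` says that membership in `Δ` is truth on this team. Deductive closure of `Δ` requires cut,
which is not immediate because of the side conditions on assumptions (`Provable.cut`).

Classical formulas are handled by classical completeness, and inclusion atoms by compression and the
elimination rule for `(φ ∧ x ⊆ a) ∨ ψ` (`IsMaxUnprov.incl_mem_iff`). Disjunction is the hard case,
since `Δ` need not contain a disjunct of each of its disjunctions. Over a finite set of variables,
the truth lemma for `φ`, quantified over all maximal theories, makes `φ` interderivable with a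
disjunction of characteristic formulas of teams. Such a formula is a classical description together
with inclusion atoms. The elimination rule moves the atoms out of a disjunction and the distribution
rule moves them in, so that only a classical disjunction remains to be decided. -/

namespace PInc

universe u

variable {V : Type u}

/-! ### Semantics -/

/-- The truth value of a classical formula under a total valuation. -/
def Cl.eval {W : Type*} (w : W → Bool) : Cl W → Bool
  | .var p => w p
  | .bot => false
  | .top => true
  | .neg α => !α.eval w
  | .and α β => α.eval w && β.eval w
  | .or α β => α.eval w || β.eval w

theorem Cl.eval_subst {W : Type*} (σ : W → Cl V) (w : V → Bool) (α : Cl W) :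
    (α.subst σ).eval w = α.eval fun i => (σ i).eval w := by
  induction α <;> simp_all [Cl.subst, Cl.eval]

/-- Flatness. For a disjunction, the team is split by which disjunct each valuation satisfies. -/
theorem Cl.sat_iff_eval {N : Set V} (α : Cl V) (X : Set (N → Bool)) :
    α.Sat X ↔ ∀ v ∈ X, α.eval (val v) = true := by
  induction α generalizing X with
  | var p => simp [Cl.Sat, Cl.eval]
  | bot => simp [Cl.Sat, Cl.eval, Set.eq_empty_iff_forall_notMem]
  | top => simp [Cl.Sat, Cl.eval]
  | neg α ih => simp [Cl.Sat, Cl.eval, ih]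
  | and α β ihα ihβ => simp only [Cl.Sat, Cl.eval, ihα, ihβ, Bool.and_eq_true]; grind
  | or α β ihα ihβ =>
    simp only [Cl.Sat, Cl.eval, ihα, ihβ, Bool.or_eq_true]
    constructor
    · rintro ⟨Y, Z, rfl, hY, hZ⟩ v (hv | hv)
      · exact Or.inl (hY v hv)
      · exact Or.inr (hZ v hv)
    · intro h
      refine ⟨{v ∈ X | α.eval (val v) = true}, {v ∈ X | β.eval (val v) = true}, ?_,
        fun v hv => hv.2, fun v hv => hv.2⟩
      ext v
      have := h v
      simp only [Set.mem_union, Set.mem_ofPred_eq]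
      tauto

theorem Cl.toFm_sat {N : Set V} (α : Cl V) (X : Set (N → Bool)) : α.toFm.Sat X ↔ α.Sat X := by
  induction α generalizing X <;> simp_all [Cl.toFm, Fm.Sat, Cl.Sat]

theorem Cl.toFm_sat_iff_eval {N : Set V} (α : Cl V) (X : Set (N → Bool)) :
    α.toFm.Sat X ↔ ∀ v ∈ X, α.eval (val v) = true :=
  (α.toFm_sat X).trans (α.sat_iff_eval X)

/-- Classical formulas are downward closed. -/
theorem Fm.IsClassical.sat_subset {N : Set V} {φ : Fm V} (h : φ.IsClassical)
    {X Y : Set (N → Bool)} (hYX : Y ⊆ X) (hX : φ.Sat X) : φ.Sat Y := by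
  obtain ⟨α, rfl⟩ := h
  rw [Cl.toFm_sat_iff_eval] at *
  exact fun v hv => hX v (hYX hv)

/-- Splittings and inclusion witnesses of the members can be united. The empty family gives truth on
the empty team. -/
theorem Fm.sat_sUnion {N : Set V} (φ : Fm V) (C : Set (Set (N → Bool)))
    (h : ∀ Y ∈ C, φ.Sat Y) : φ.Sat (⋃₀ C) := by
  induction φ generalizing C with
  | var p => rintro v ⟨Y, hY, hv⟩; exact h Y hY v hv
  | bot => exact Set.sUnion_eq_empty.2 h
  | top => trivial
  | neg α => rintro v ⟨Y, hY, hv⟩; exact h Y hY v hv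
  | and φ ψ ihφ ihψ => exact ⟨ihφ C fun Y hY => (h Y hY).1, ihψ C fun Y hY => (h Y hY).2⟩
  | or φ ψ ihφ ihψ =>
    choose! F G hFG hF hG using h
    refine ⟨⋃₀ (F '' C), ⋃₀ (G '' C), ?_, ihφ _ ?_, ihψ _ ?_⟩
    · rw [Set.sUnion_image, Set.sUnion_image, Set.sUnion_eq_biUnion, Set.iUnion₂_congr hFG]
      simp only [Set.iUnion_union_distrib]
    · rintro _ ⟨Y, hY, rfl⟩; exact hF Y hY
    · rintro _ ⟨Y, hY, rfl⟩; exact hG Y hY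
  | incl l =>
    rintro v ⟨Y, hY, hv⟩
    obtain ⟨w, hw, hl⟩ := h Y hY v hv
    exact ⟨w, ⟨Y, hY, hw⟩, hl⟩

theorem Fm.sat_union {N : Set V} (φ : Fm V) {Y Z : Set (N → Bool)} (hY : φ.Sat Y)
    (hZ : φ.Sat Z) : φ.Sat (Y ∪ Z) := by
  rw [← Set.sUnion_pair]
  exact φ.sat_sUnion _ (by rintro _ (rfl | rfl) <;> assumption)

theorem Fm.sat_empty {N : Set V} (φ : Fm V) : φ.Sat (∅ : Set (N → Bool)) := by
  rw [← Set.sUnion_empty]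
  exact φ.sat_sUnion _ (by simp)

theorem Cl.eval_congr {M : Set V} (α : Cl V) (hα : α.vars ⊆ M) {w w' : V → Bool}
    (h : ∀ p ∈ M, w p = w' p) : α.eval w = α.eval w' := by
  induction α <;> simp_all [Cl.vars, Cl.eval]

/-- Truth depends only on the variables that occur in the formula. -/
theorem Fm.sat_image {N N' M : Set V} (r : (N → Bool) → (N' → Bool))
    (hr : ∀ v, ∀ p ∈ M, val (r v) p = val v p) (φ : Fm V) (hφ : φ.vars ⊆ M)
    (X : Set (N → Bool)) : φ.Sat (r '' X) ↔ φ.Sat X := by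
  induction φ generalizing X with
  | var p =>
    have hp : p ∈ M := hφ rfl
    simp [Fm.Sat, hr _ p hp]
  | bot => simp [Fm.Sat]
  | top => simp [Fm.Sat]
  | neg α =>
    simp only [Fm.Sat, Cl.sat_iff_eval, Set.forall_mem_image, Set.mem_singleton_iff, forall_eq,
      α.eval_congr hφ (hr _)]
  | and φ ψ ihφ ihψ =>
    simp only [Fm.Sat, ihφ (Set.subset_union_left.trans hφ), ihψ (Set.subset_union_right.trans hφ)]
  | or φ ψ ihφ ihψ =>
    replace ihφ := ihφ (Set.subset_union_left.trans hφ)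
    replace ihψ := ihψ (Set.subset_union_right.trans hφ)
    constructor
    · rintro ⟨Y, Z, h, hY, hZ⟩
      -- The map `r` may identify valuations, so a splitting of the image is pulled back to full
      -- preimages inside `X`.
      have himage : ∀ Y ⊆ r '' X, r '' (X ∩ r ⁻¹' Y) = Y := fun Y hY => by
        rw [Set.image_inter_preimage, Set.inter_eq_right.2 hY]
      refine ⟨X ∩ r ⁻¹' Y, X ∩ r ⁻¹' Z, ?_, ?_, ?_⟩
      · rw [← Set.inter_union_distrib_left, ← Set.preimage_union, ← h]
        exact (Set.inter_eq_left.2 (Set.subset_preimage_image r X)).symm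
      · rw [← ihφ, himage _ (h ▸ Set.subset_union_left)]; exact hY
      · rw [← ihψ, himage _ (h ▸ Set.subset_union_right)]; exact hZ
    · rintro ⟨Y, Z, rfl, hY, hZ⟩
      exact ⟨r '' Y, r '' Z, Set.image_union _ _ _, (ihφ Y).2 hY, (ihψ Z).2 hZ⟩
  | incl l =>
    have key : ∀ v : N → Bool, ∀ e ∈ l, argVal (r v) e.2 = argVal v e.2 := by
      rintro v ⟨x, p | b⟩ he
      · exact hr v p (hφ ⟨x, he⟩)
      · rfl
    simp only [Fm.Sat, Set.forall_mem_image, Set.exists_mem_image]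
    refine forall₂_congr fun v _ => exists_congr fun w => and_congr_right fun _ =>
      forall₂_congr fun e he => ?_
    rw [key w e he]
    rfl

theorem eval_constCl (w : V → Bool) (b : Bool) : (constCl b : Cl V).eval w = b := by
  cases b <;> rfl

theorem eval_toCl {N : Set V} (v : N → Bool) (a : Arg V) :
    a.toCl.eval (val v) = argVal v a := by
  cases a with
  | var p => rfl
  | const b => exact eval_constCl _ b

theorem eval_lit {N : Set V} (v : N → Bool) (e : Bool × Arg V) :
    (lit e).eval (val v) = true ↔ e.1 = argVal v e.2 := by
  obtain ⟨_ | _, p | b⟩ := e <;> simp [lit, Cl.eval, argVal, eval_constCl]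

theorem eval_lits {N : Set V} (v : N → Bool) (l : List (Bool × Arg V)) :
    (lits l).eval (val v) = true ↔ ∀ e ∈ l, e.1 = argVal v e.2 := by
  induction l with
  | nil => simp [lits, Cl.eval]
  | cons e l ih =>
    cases l with
    | nil => simp [lits, eval_lit]
    | cons e' l => simp only [lits, Cl.eval, Bool.and_eq_true, ih, eval_lit, List.forall_mem_cons]

/-- `orLits` for a classical formula, as a classical formula. -/
def orLitsCl (α : Cl V) (ls : List (List (Bool × Arg V))) : Cl V :=
  ls.foldl (fun β l => .or β (lits l)) α

theorem toFm_orLitsCl (α : Cl V) (ls : List (List (Bool × Arg V))) :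
    (orLitsCl α ls).toFm = orLits α.toFm ls := by
  induction ls generalizing α with
  | nil => rfl
  | cons l ls ih => exact ih _

theorem eval_orLitsCl (w : V → Bool) (α : Cl V) (ls : List (List (Bool × Arg V))) :
    (orLitsCl α ls).eval w = true ↔ α.eval w = true ∨ ∃ l ∈ ls, (lits l).eval w = true := by
  induction ls generalizing α with
  | nil => simp [orLitsCl]
  | cons l ls ih =>
    have := ih (.or α (lits l))
    simp only [orLitsCl, List.foldl_cons] at *
    simp [this, Cl.eval, or_assoc]

theorem sat_andIncls {N : Set V} (φ : Fm V) (ls : List (List (Bool × Arg V)))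
    (X : Set (N → Bool)) :
    (andIncls φ ls).Sat X ↔ φ.Sat X ∧ ∀ l ∈ ls, (Fm.incl l).Sat X := by
  induction ls generalizing φ with
  | nil => simp [andIncls]
  | cons l ls ih =>
    have := ih (.and φ (.incl l))
    simp only [andIncls, List.foldl_cons] at *
    rw [this, List.forall_mem_cons, ← and_assoc]
    rfl

theorem sat_orLits {N : Set V} (φ : Fm V) (ls : List (List (Bool × Arg V)))
    {Y W : Set (N → Bool)} (hφ : φ.Sat Y)
    (hW : ∀ v ∈ W, ∃ l ∈ ls, ∀ e ∈ l, e.1 = argVal v e.2) : (orLits φ ls).Sat (Y ∪ W) := by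
  induction ls generalizing φ Y W with
  | nil =>
    obtain rfl : W = ∅ := Set.eq_empty_iff_forall_notMem.2 fun v hv => by simpa using hW v hv
    simpa [orLits] using hφ
  | cons l ls ih =>
    -- The valuations handled by the first new disjunct are moved from `W` to `Y`.
    let U : Set (N → Bool) := {v ∈ W | ∀ e ∈ l, e.1 = argVal v e.2}
    have h := ih (φ := .or φ (lits l).toFm) (Y := Y ∪ U) (W := W \ U)
      ⟨Y, U, rfl, hφ, (Cl.toFm_sat_iff_eval _ _).2 fun v hv => (eval_lits v l).2 hv.2⟩ (by
        rintro v ⟨hv, hvU⟩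
        obtain ⟨l', hl', he⟩ := hW v hv
        rcases List.mem_cons.1 hl' with rfl | hl'
        · exact (hvU ⟨hv, he⟩).elim
        · exact ⟨l', hl', he⟩)
    rwa [Set.union_assoc, Set.union_sdiff_cancel fun v hv => hv.1] at h

theorem incl_sat_of_mem {N : Set V} {X : Set (N → Bool)} {l : List (Bool × Arg V)} {u : N → Bool}
    (hu : u ∈ X) (h : ∀ e ∈ l, e.1 = argVal u e.2) : (Fm.incl l).Sat X :=
  fun _ _ => ⟨u, hu, h⟩

/-! ### Soundness -/

theorem Deriv.sound {A : Set (Fm V)} {φ : Fm V} (h : Deriv A φ) {N : Set V}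
    (X : Set (N → Bool)) (hX : ∀ γ ∈ A, γ.Sat X) : φ.Sat X := by
  -- The side condition at work: classical side assumptions survive the passage to the subteam on
  -- which the discharged formula holds.
  have cl : ∀ {A : Set (Fm V)} {φ : Fm V} {X Y : Set (N → Bool)},
      (∀ γ ∈ A \ {φ}, γ.IsClassical) → Y ⊆ X → (∀ γ ∈ A \ {φ}, γ.Sat X) → φ.Sat Y →
      ∀ γ ∈ A, γ.Sat Y := by
    intro A φ X Y hA hYX hX hφ γ hγ
    by_cases h : γ = φ
    · exact h ▸ hφ
    · exact (hA γ ⟨hγ, h⟩).sat_subset hYX (hX γ ⟨hγ, h⟩)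
  induction h generalizing X with
  | hyp φ => exact hX φ rfl
  | topI => trivial
  | @negI A α _ hA ih =>
    intro v hv hα
    have := ih {v} (cl hA (Set.singleton_subset_iff.2 hv) hX ((α.toFm_sat _).2 hα))
    exact Set.singleton_ne_empty v this
  | @negE A B α φ _ _ ih₁ ih₂ =>
    have h₁ := (α.toFm_sat_iff_eval X).1 (ih₁ X fun γ hγ => hX γ (.inl hγ))
    have h₂ := ih₂ X fun γ hγ => hX γ (.inr hγ)
    obtain rfl : X = ∅ := Set.eq_empty_iff_forall_notMem.2 fun v hv =>
      h₂ v hv ((α.sat_iff_eval _).2 (by simpa using h₁ v hv))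
    exact φ.sat_empty
  | @raa A α _ hA ih =>
    rw [Cl.toFm_sat_iff_eval]
    intro v hv
    by_contra hα
    have := ih {v} (cl hA (Set.singleton_subset_iff.2 hv) hX (by
      simpa [Fm.Sat, Cl.sat_iff_eval] using hα))
    exact Set.singleton_ne_empty v this
  | andI _ _ ih₁ ih₂ =>
    exact ⟨ih₁ X fun γ hγ => hX γ (.inl hγ), ih₂ X fun γ hγ => hX γ (.inr hγ)⟩
  | andE₁ _ ih => exact (ih X hX).1
  | andE₂ _ ih => exact (ih X hX).2
  | @orI₁ A φ ψ _ ih => exact ⟨X, ∅, by simp, ih X hX, ψ.sat_empty⟩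
  | @orI₂ A φ ψ _ ih => exact ⟨∅, X, by simp, ψ.sat_empty, ih X hX⟩
  | @orE A B C φ ψ χ _ _ hB _ hC ih₁ ih₂ ih₃ =>
    obtain ⟨Y, Z, rfl, hY, hZ⟩ := ih₁ X fun γ hγ => hX γ (.inl (.inl hγ))
    exact χ.sat_union
      (ih₂ Y (cl hB Set.subset_union_left (fun γ hγ => hX γ (.inl (.inr hγ))) hY))
      (ih₃ Z (cl hC Set.subset_union_right (fun γ hγ => hX γ (.inr hγ)) hZ))
  | inclExc _ ih =>
    intro v hv
    obtain ⟨u, hu, h⟩ := ih X hX v hv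
    exact ⟨u, hu, fun e he => h e (by simp only [List.mem_append] at *; tauto)⟩
  | inclCtr _ ih =>
    intro v hv
    obtain ⟨u, hu, h⟩ := ih X hX v hv
    exact ⟨u, hu, fun e he => h e (by simp only [List.mem_append] at *; tauto)⟩
  | inclWk _ ih =>
    intro v hv
    obtain ⟨u, hu, h⟩ := ih X hX v hv
    exact ⟨u, hu, fun e he => h e (by simp only [List.mem_append] at *; tauto)⟩
  | inclTrs t _ _ ih₁ ih₂ =>
    intro v hv
    obtain ⟨u, hu, h⟩ := ih₁ X (fun γ hγ => hX γ (.inl hγ)) v hv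
    obtain ⟨w, hw, h'⟩ := ih₂ X (fun γ hγ => hX γ (.inr hγ)) u hu
    refine ⟨w, hw, ?_⟩
    simp only [List.forall_mem_map] at *
    exact fun e he => (h e he).trans (h' e he)
  | inclId a =>
    intro v hv
    refine ⟨v, hv, ?_⟩
    exact List.forall_mem_map.2 fun _ _ => rfl
  | inclCmp l α _ _ _ ih₁ ih₂ =>
    have h₂ := (Cl.toFm_sat_iff_eval _ X).1 (ih₂ X fun γ hγ => hX γ (.inr hγ))
    rw [Cl.toFm_sat_iff_eval]
    intro v hv
    obtain ⟨u, hu, h⟩ := ih₁ X (fun γ hγ => hX γ (.inl hγ)) v hv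
    have := h₂ u hu
    simp only [Cl.eval_subst, eval_toCl, eval_constCl] at *
    rw [← this]
    congr 1
    ext i
    exact h (l.get i) (l.get_mem i)
  | inclExtConst x _ ih =>
    intro v hv
    obtain ⟨u, hu, h⟩ := ih X hX v hv
    exact ⟨u, hu, List.forall_mem_cons.2 ⟨rfl, h⟩⟩
  | inclExtPos _ _ ih₁ ih₂ =>
    intro v hv
    obtain ⟨u, hu, h⟩ := ih₂ X (fun γ hγ => hX γ (.inr hγ)) v hv
    have := ih₁ X (fun γ hγ => hX γ (.inl hγ)) u hu
    exact ⟨u, hu, List.forall_mem_cons.2 ⟨this.symm, h⟩⟩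
  | inclExtNeg _ _ ih₁ ih₂ =>
    intro v hv
    obtain ⟨u, hu, h⟩ := ih₂ X (fun γ hγ => hX γ (.inr hγ)) v hv
    have := ih₁ X (fun γ hγ => hX γ (.inl hγ)) u hu
    refine ⟨u, hu, List.forall_mem_cons.2 ⟨?_, h⟩⟩
    simpa [Cl.sat_iff_eval, Cl.eval, argVal] using this
  | @orInclE A B C D φ ψ χ l _ _ _ _ ih₁ ih₂ ih₃ ih₄ =>
    obtain ⟨Y, Z, rfl, ⟨hφ, hl⟩, hZ⟩ := ih₁ X fun γ hγ => hX γ (.inl (.inl (.inl hγ)))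
    -- If `Y` is empty, the whole team satisfies `ψ`. Otherwise the witness of the atom in `Y` makes
    -- the atom true on the whole team, and the third subderivation applies.
    rcases Y.eq_empty_or_nonempty with rfl | ⟨v, hv⟩
    · rw [Set.empty_union] at *
      refine ih₃ Z fun γ hγ => ?_
      by_cases h : γ = ψ
      · exact h ▸ hZ
      · exact hX γ (.inl (.inr ⟨hγ, h⟩))
    · refine ih₄ _ fun γ hγ => ?_
      by_cases h : γ ∈ ({.or φ ψ, .incl l} : Set (Fm V))
      · rcases h with rfl | rfl
        · exact ⟨Y, Z, rfl, hφ, hZ⟩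
        · obtain ⟨u, hu, h⟩ := hl v hv
          exact incl_sat_of_mem (.inl hu) h
      · exact hX γ (.inr ⟨hγ, h⟩)
  | @inclDst A φ ψ ls B _ _ ih₁ ih₂ =>
    obtain ⟨Y, Z, rfl, hY, hZ⟩ := ih₁ X fun γ hγ => hX γ (.inl hγ)
    rcases (Y ∪ Z).eq_empty_or_nonempty with h | ⟨v, hv⟩
    · rw [h]; exact Fm.sat_empty _
    have hls : ∀ l ∈ ls, ∃ u ∈ Y ∪ Z, ∀ e ∈ l, e.1 = argVal u e.2 := fun l hl => by
      obtain ⟨i, rfl⟩ := List.get_of_mem hl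
      exact ih₂ i _ (fun γ hγ => hX γ (.inr (Set.mem_iUnion.2 ⟨i, hγ⟩))) v hv
    -- The left part of the splitting is enlarged by all witnesses of the atoms, so that the atoms
    -- become true there.
    let W : Set (N → Bool) := {u ∈ Y ∪ Z | ∃ l ∈ ls, ∀ e ∈ l, e.1 = argVal u e.2}
    refine ⟨Y ∪ W, Z, ?_, (sat_andIncls _ _ _).2 ⟨sat_orLits φ ls hY fun v hv => hv.2, ?_⟩, hZ⟩
    · ext u
      simp only [Set.mem_union, W, Set.mem_ofPred_eq]
      tauto
    · intro l hl
      obtain ⟨u, hu, h⟩ := hls l hl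
      exact incl_sat_of_mem (u := u) (.inr ⟨hu, l, hl, h⟩) h

/-! ### Admissibility of cut -/

/-- Compactness, needed for unions of chains in Zorn's lemma. -/
theorem Deriv.finite {A : Set (Fm V)} {φ : Fm V} (h : Deriv A φ) : A.Finite := by
  induction h with
  | inclDst ls B _ _ ih₁ ih₂ => exact ih₁.union (Set.finite_iUnion ih₂)
  | _ => simp_all [Set.Finite.sdiff]

/-- Substitution of a derivation of `φ` for the undischarged assumption `φ`. The condition makes
sure that the side conditions of the rules are preserved. -/
theorem Deriv.provable_subst {A B : Set (Fm V)} {φ χ : Fm V} (hB : Deriv B χ) (hA : Deriv A φ)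
    (hφ : φ.IsClassical → ∀ γ ∈ A, γ.IsClassical) : Provable (B \ {φ} ∪ A) χ := by
  -- For a subderivation discharging `D` under a side condition: if `φ` stays open, it is classical,
  -- hence so are the assumptions `A` put in its place. Otherwise the subderivation is kept
  -- unchanged.
  have branch : ∀ {B D : Set (Fm V)} {χ : Fm V}, Deriv B χ → Provable (B \ {φ} ∪ A) χ →
      (∀ γ ∈ B \ D, γ.IsClassical) →
      ∃ B', Deriv B' χ ∧ B' \ D ⊆ (B \ D) \ {φ} ∪ A ∧ ∀ γ ∈ B' \ D, γ.IsClassical := by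
    rintro B D χ hB ⟨B', hsub, hB'⟩ hcl
    by_cases h : φ ∈ B \ D
    · have hAcl := hφ (hcl _ h)
      have hsub' : B' \ D ⊆ (B \ D) \ {φ} ∪ A := by
        rintro γ ⟨hγ, hD⟩
        rcases hsub hγ with hγ | hγ
        · exact .inl ⟨⟨hγ.1, hD⟩, hγ.2⟩
        · exact .inr hγ
      refine ⟨B', hB', hsub', fun γ hγ => ?_⟩
      rcases hsub' hγ with hγ | hγ
      · exact hcl γ hγ.1
      · exact hAcl γ hγ
    · exact ⟨B, hB, fun γ hγ => .inl ⟨hγ, fun hγφ => h (hγφ ▸ hγ)⟩, hcl⟩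
  induction hB with
  | hyp ψ =>
    by_cases h : ψ = φ
    · exact ⟨A, Set.subset_union_right, h ▸ hA⟩
    · exact ⟨{ψ}, by simp [h], .hyp ψ⟩
  | topI => exact ⟨∅, Set.empty_subset _, .topI⟩
  | negI h hc ih =>
    obtain ⟨B', h', hsub, hcl⟩ := branch h ih hc
    exact ⟨_, hsub, h'.negI hcl⟩
  | raa h hc ih =>
    obtain ⟨B', h', hsub, hcl⟩ := branch h ih hc
    exact ⟨_, hsub, h'.raa hcl⟩
  | negE ψ _ _ ih₁ ih₂ =>
    obtain ⟨B₁, hs₁, h₁⟩ := ih₁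
    obtain ⟨B₂, hs₂, h₂⟩ := ih₂
    exact ⟨_, by grind, h₁.negE ψ h₂⟩
  | andI _ _ ih₁ ih₂ =>
    obtain ⟨B₁, hs₁, h₁⟩ := ih₁
    obtain ⟨B₂, hs₂, h₂⟩ := ih₂
    exact ⟨_, by grind, h₁.andI h₂⟩
  | andE₁ _ ih => exact ih.imp fun _ h => ⟨h.1, h.2.andE₁⟩
  | andE₂ _ ih => exact ih.imp fun _ h => ⟨h.1, h.2.andE₂⟩
  | orI₁ ψ _ ih => exact ih.imp fun _ h => ⟨h.1, h.2.orI₁ ψ⟩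
  | orI₂ ψ _ ih => exact ih.imp fun _ h => ⟨h.1, h.2.orI₂ ψ⟩
  | orE _ h₂ hc₂ h₃ hc₃ ih₁ ih₂ ih₃ =>
    obtain ⟨B₁, hs₁, h₁⟩ := ih₁
    obtain ⟨B₂, h₂, hs₂, hc₂⟩ := branch h₂ ih₂ hc₂
    obtain ⟨B₃, h₃, hs₃, hc₃⟩ := branch h₃ ih₃ hc₃
    exact ⟨_, by grind, h₁.orE h₂ hc₂ h₃ hc₃⟩
  | inclExc _ ih => exact ih.imp fun _ h => ⟨h.1, h.2.inclExc⟩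
  | inclCtr _ ih => exact ih.imp fun _ h => ⟨h.1, h.2.inclCtr⟩
  | inclWk _ ih => exact ih.imp fun _ h => ⟨h.1, h.2.inclWk⟩
  | inclTrs t _ _ ih₁ ih₂ =>
    obtain ⟨B₁, hs₁, h₁⟩ := ih₁
    obtain ⟨B₂, hs₂, h₂⟩ := ih₂
    exact ⟨_, by grind, h₁.inclTrs t h₂⟩
  | inclId a => exact ⟨∅, Set.empty_subset _, .inclId a⟩
  | inclCmp l α hα _ _ ih₁ ih₂ =>
    obtain ⟨B₁, hs₁, h₁⟩ := ih₁
    obtain ⟨B₂, hs₂, h₂⟩ := ih₂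
    exact ⟨_, by grind, h₁.inclCmp l α hα h₂⟩
  | inclExtConst x _ ih => exact ih.imp fun _ h => ⟨h.1, h.2.inclExtConst x⟩
  | inclExtPos _ _ ih₁ ih₂ =>
    obtain ⟨B₁, hs₁, h₁⟩ := ih₁
    obtain ⟨B₂, hs₂, h₂⟩ := ih₂
    exact ⟨_, by grind, h₁.inclExtPos h₂⟩
  | inclExtNeg _ _ ih₁ ih₂ =>
    obtain ⟨B₁, hs₁, h₁⟩ := ih₁
    obtain ⟨B₂, hs₂, h₂⟩ := ih₂
    exact ⟨_, by grind, h₁.inclExtNeg h₂⟩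
  | orInclE _ _ _ _ ih₁ ih₂ ih₃ ih₄ =>
    obtain ⟨B₁, hs₁, h₁⟩ := ih₁
    obtain ⟨B₂, hs₂, h₂⟩ := ih₂
    obtain ⟨B₃, hs₃, h₃⟩ := ih₃
    obtain ⟨B₄, hs₄, h₄⟩ := ih₄
    exact ⟨_, by grind, h₁.orInclE h₂ h₃ h₄⟩
  | inclDst ls B _ _ ih₁ ih₂ =>
    obtain ⟨B₁, hs₁, h₁⟩ := ih₁
    choose B₂ hs₂ h₂ using ih₂
    refine ⟨_, Set.union_subset ?_ (Set.iUnion_subset fun i => ?_), h₁.inclDst ls B₂ h₂⟩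
    · grind
    · intro γ hγ
      rcases hs₂ i hγ with hγ | hγ
      · exact .inl ⟨.inr (Set.mem_iUnion.2 ⟨i, hγ.1⟩), hγ.2⟩
      · exact .inr hγ

/-! ### Derived rules of the calculus. -/

namespace Provable

variable {Γ Δ : Set (Fm V)} {φ ψ χ : Fm V} {α β : Cl V} {l : List (Bool × Arg V)}

theorem mono (h : Provable Γ φ) (hΓ : Γ ⊆ Δ) : Provable Δ φ :=
  h.imp fun _ hA => ⟨hA.1.trans hΓ, hA.2⟩

theorem hyp (h : φ ∈ Γ) : Provable Γ φ := ⟨{φ}, Set.singleton_subset_iff.2 h, .hyp φ⟩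

theorem self : Provable {φ} φ := hyp rfl

theorem topI : Provable Γ .top := ⟨∅, Set.empty_subset _, .topI⟩

theorem negE (h₁ : Provable Γ α.toFm) (h₂ : Provable Γ (.neg α)) (φ : Fm V) : Provable Γ φ := by
  obtain ⟨A, hA, h₁⟩ := h₁
  obtain ⟨B, hB, h₂⟩ := h₂
  exact ⟨_, Set.union_subset hA hB, h₁.negE φ h₂⟩

theorem andI (h₁ : Provable Γ φ) (h₂ : Provable Γ ψ) : Provable Γ (.and φ ψ) := by
  obtain ⟨A, hA, h₁⟩ := h₁
  obtain ⟨B, hB, h₂⟩ := h₂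
  exact ⟨_, Set.union_subset hA hB, h₁.andI h₂⟩

theorem andE₁ (h : Provable Γ (.and φ ψ)) : Provable Γ φ := h.imp fun _ h => ⟨h.1, h.2.andE₁⟩

theorem andE₂ (h : Provable Γ (.and φ ψ)) : Provable Γ ψ := h.imp fun _ h => ⟨h.1, h.2.andE₂⟩

theorem orI₁ (h : Provable Γ φ) (ψ : Fm V) : Provable Γ (.or φ ψ) :=
  h.imp fun _ h => ⟨h.1, h.2.orI₁ ψ⟩

theorem orI₂ (h : Provable Γ φ) (ψ : Fm V) : Provable Γ (.or ψ φ) :=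
  h.imp fun _ h => ⟨h.1, h.2.orI₂ ψ⟩

theorem negI (hΓ : ∀ γ ∈ Γ, γ.IsClassical) (h : Provable (insert α.toFm Γ) .bot) :
    Provable Γ (.neg α) := by
  obtain ⟨A, hA, h⟩ := h
  have hsub : A \ {α.toFm} ⊆ Γ := by grind
  exact ⟨_, hsub, h.negI fun γ hγ => hΓ γ (hsub hγ)⟩

theorem raa (hΓ : ∀ γ ∈ Γ, γ.IsClassical) (h : Provable (insert (.neg α) Γ) .bot) :
    Provable Γ α.toFm := by
  obtain ⟨A, hA, h⟩ := h
  have hsub : A \ {.neg α} ⊆ Γ := by grind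
  exact ⟨_, hsub, h.raa fun γ hγ => hΓ γ (hsub hγ)⟩

theorem orE {T : Set (Fm V)} (hT : ∀ γ ∈ T, γ.IsClassical) (hTΓ : T ⊆ Γ)
    (h : Provable Γ (.or φ ψ)) (h₁ : Provable (insert φ T) χ) (h₂ : Provable (insert ψ T) χ) :
    Provable Γ χ := by
  obtain ⟨A, hA, h⟩ := h
  obtain ⟨B, hB, h₁⟩ := h₁
  obtain ⟨C, hC, h₂⟩ := h₂
  have hBT : B \ {φ} ⊆ T := by grind
  have hCT : C \ {ψ} ⊆ T := by grind
  exact ⟨_, by grind, h.orE h₁ (fun γ hγ => hT γ (hBT hγ)) h₂ fun γ hγ => hT γ (hCT hγ)⟩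

theorem orE' (h : Provable Γ (.or φ ψ)) (h₁ : Provable {φ} χ) (h₂ : Provable {ψ} χ) :
    Provable Γ χ :=
  orE (T := ∅) (by simp) (Set.empty_subset _) h (by simpa using h₁) (by simpa using h₂)

theorem botE (h : Provable Γ .bot) (φ : Fm V) : Provable Γ φ := by
  refine negE (α := .bot) h ?_ φ
  exact (negI (Γ := ∅) (by simp) (hyp (Set.mem_insert _ _))).mono (Set.empty_subset _)

theorem inclNil : Provable Γ (.incl []) := ⟨∅, Set.empty_subset _, .inclId []⟩

/-- Direct substitution fails for a classical `φ` derived from nonclassical assumptions. Then `φ` is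
weakened to `(⊥ ∧ incl []) ∨ φ` and eliminated by the rule without side condition. In the third case
`φ` is recovered from the classical formula `⊥ ∨ φ`, where substitution is harmless. -/
theorem cut (h₁ : Provable Γ φ) (h₂ : Provable (insert φ Γ) χ) : Provable Γ χ := by
  obtain ⟨A, hA, h₁⟩ := h₁
  obtain ⟨B, hB, h₂⟩ := h₂
  by_cases hφ : φ.IsClassical
  · obtain ⟨α, rfl⟩ := hφ
    have hcl : ∀ γ ∈ ({.or .bot α.toFm} : Set (Fm V)), γ.IsClassical := by
      rintro _ rfl
      exact ⟨.or .bot α, rfl⟩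
    have hα : Provable {.or .bot α.toFm} α.toFm :=
      orE' self (botE self _) self
    obtain ⟨A', hA', hα⟩ := hα
    obtain ⟨D, hD, h₃⟩ := h₂.provable_subst hα fun _ γ hγ => hcl γ (hA' hγ)
    obtain ⟨C, hC, h₄⟩ := botE (Γ := {.bot}) self χ
    refine ⟨_, ?_, (h₁.orI₂ (.and .bot (.incl []))).orInclE h₄ h₂ h₃⟩
    grind
  · exact (h₂.provable_subst h₁ fun h => (hφ h).elim).mono (by grind)

theorem cut' (h₁ : Provable Γ φ) (h₂ : Provable {φ} χ) : Provable Γ χ :=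
  h₁.cut (h₂.mono (by simp))

/-- The elimination rule for `(φ ∧ x ⊆ a) ∨ ψ`; one of its three cases is redundant. -/
theorem orInclE (h : Provable Γ (.or (.and φ (.incl l)) ψ)) (h₁ : Provable (insert ψ Γ) χ)
    (h₂ : Provable (insert (.or φ ψ) (insert (.incl l) Γ)) χ) : Provable Γ χ := by
  have h₃ : Provable (insert φ (insert (.incl l) Γ)) χ :=
    ((hyp (Set.mem_insert _ _)).orI₁ ψ).cut (h₂.mono (by grind))
  obtain ⟨A, hA, h⟩ := h
  obtain ⟨B, hB, h₁⟩ := h₁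
  obtain ⟨C, hC, h₂⟩ := h₂
  obtain ⟨D, hD, h₃⟩ := h₃
  exact ⟨_, by grind, h.orInclE h₃ h₁ h₂⟩

theorem inclDst (ls : List (List (Bool × Arg V))) (h : Provable Γ (.or φ ψ))
    (hls : ∀ l ∈ ls, Provable Γ (.incl l)) : Provable Γ (.or (andIncls (orLits φ ls) ls) ψ) := by
  obtain ⟨A, hA, h⟩ := h
  choose B hB hls using fun i => hls (ls.get i) (ls.get_mem i)
  exact ⟨_, Set.union_subset hA (Set.iUnion_subset hB), h.inclDst ls B hls⟩

theorem inclCmp (l : List (Bool × Arg V)) (α : Cl (Fin l.length)) (hα : α.ConstFree)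
    (h₁ : Provable Γ (.incl l))
    (h₂ : Provable Γ (α.subst fun i => (l.get i).2.toCl).toFm) :
    Provable Γ (α.subst fun i => constCl (l.get i).1).toFm := by
  obtain ⟨A, hA, h₁⟩ := h₁
  obtain ⟨B, hB, h₂⟩ := h₂
  exact ⟨_, Set.union_subset hA hB, h₁.inclCmp l α hα h₂⟩

/-- An inclusion atom `x ⊆ a` follows from the conjuncts of `a^x`. -/
theorem incl_of_lits (h : ∀ e ∈ l, Provable Γ (lit e).toFm) : Provable Γ (.incl l) := by
  induction l with
  | nil => exact inclNil
  | cons e l ih =>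
    obtain ⟨he, hl⟩ := List.forall_mem_cons.1 h
    obtain ⟨B, hB, hl⟩ := ih hl
    have const : ∀ x, Provable Γ (.incl ((x, .const x) :: l)) :=
      fun x => ⟨B, hB, hl.inclExtConst x⟩
    obtain ⟨x, p | b⟩ := e
    · obtain ⟨A, hA, he⟩ := he
      cases x
      · exact ⟨_, Set.union_subset hA hB, he.inclExtNeg hl⟩
      · exact ⟨_, Set.union_subset hA hB, he.inclExtPos hl⟩
    · by_cases hxb : x = b
      · exact hxb ▸ const x
      · refine botE ?_ _
        cases x <;> cases b <;> first | exact (hxb rfl).elim | exact he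

theorem or_imp (h : Provable Γ (.or φ ψ)) {φ' ψ' : Fm V} (hφ : Provable {φ} φ')
    (hψ : Provable {ψ} ψ') : Provable Γ (.or φ' ψ') :=
  h.orE' (hφ.orI₁ ψ') (hψ.orI₂ φ')

theorem or_comm (h : Provable Γ (.or φ ψ)) : Provable Γ (.or ψ φ) :=
  h.orE' (self.orI₂ ψ) (self.orI₁ φ)

theorem or_assoc (h : Provable Γ (.or (.or φ ψ) χ)) : Provable Γ (.or φ (.or ψ χ)) :=
  h.orE' (self.or_imp self (self.orI₁ χ)) ((self.orI₂ ψ).orI₂ φ)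

theorem or_left_comm (h : Provable Γ (.or φ (.or ψ χ))) : Provable Γ (.or ψ (.or φ χ)) :=
  h.orE' ((self.orI₁ χ).orI₂ ψ) (self.or_imp self (self.orI₂ φ))

theorem andIncls_iff {ls : List (List (Bool × Arg V))} :
    Provable Γ (andIncls φ ls) ↔ Provable Γ φ ∧ ∀ l ∈ ls, Provable Γ (.incl l) := by
  induction ls generalizing φ with
  | nil => simp [andIncls]
  | cons l ls ih =>
    have := ih (φ := .and φ (.incl l))
    simp only [andIncls, List.foldl_cons] at *
    rw [this, List.forall_mem_cons, ← and_assoc]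
    exact and_congr_left fun _ => ⟨fun h => ⟨h.andE₁, h.andE₂⟩, fun h => h.1.andI h.2⟩

end Provable

/-! ### Maximal theories -/

/-- `Δ` is a maximal subset of `K` that does not prove `χ`. -/
structure IsMaxUnprov (K : Set (Fm V)) (χ : Fm V) (Δ : Set (Fm V)) : Prop where
  subset : Δ ⊆ K
  not_provable : ¬ Provable Δ χ
  provable_insert : ∀ φ ∈ K, φ ∉ Δ → Provable (insert φ Δ) χ

theorem exists_isMaxUnprov {K Γ : Set (Fm V)} {χ : Fm V} (hK : Γ ⊆ K) (h : ¬ Provable Γ χ) :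
    ∃ Δ, Γ ⊆ Δ ∧ IsMaxUnprov K χ Δ := by
  obtain ⟨Δ, hΓΔ, hΔ⟩ := zorn_subset_nonempty {Δ | Δ ⊆ K ∧ ¬ Provable Δ χ} (by
    intro c hc hchain hne
    refine ⟨⋃₀ c, ⟨Set.sUnion_subset fun Δ hΔ => (hc hΔ).1, ?_⟩,
      fun Δ hΔ => Set.subset_sUnion_of_mem hΔ⟩
    rintro ⟨A, hA, hAχ⟩
    obtain ⟨Δ, hΔ, hAΔ⟩ := hchain.directedOn.exists_mem_subset_of_finite_of_subset_sUnion
      hne hAχ.finite hA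
    exact (hc hΔ).2 ⟨A, hAΔ, hAχ⟩) Γ ⟨hK, h⟩
  refine ⟨Δ, hΓΔ, hΔ.prop.1, hΔ.prop.2, fun φ hφ hφΔ => ?_⟩
  by_contra hn
  exact hφΔ (hΔ.le_of_ge ⟨Set.insert_subset hφ hΔ.prop.1, hn⟩ (Set.subset_insert φ Δ)
    (Set.mem_insert φ Δ))

theorem IsMaxUnprov.mem_iff {K Δ : Set (Fm V)} {χ : Fm V} (h : IsMaxUnprov K χ Δ) {φ : Fm V}
    (hφ : φ ∈ K) : φ ∈ Δ ↔ Provable Δ φ :=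
  ⟨.hyp, fun hp => by_contra fun hn => h.not_provable (hp.cut (h.provable_insert φ hφ hn))⟩

/-- Completeness of the classical fragment. -/
theorem provable_of_eval {T : Set (Fm V)} {α : Cl V} (hT : ∀ γ ∈ T, γ.IsClassical)
    (h : ∀ w : V → Bool, (∀ β : Cl V, β.toFm ∈ T → β.eval w = true) → α.eval w = true) :
    Provable T α.toFm := by
  classical
  by_contra hn
  -- Maximality among classical formulas only, so that `negI` and `orE` apply with all of `Δ` as
  -- side assumptions.
  obtain ⟨Δ, hTΔ, hΔ⟩ := exists_isMaxUnprov (K := {γ | γ.IsClassical}) (χ := .bot)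
    (Γ := insert (.neg α) T) (Set.insert_subset ⟨.neg α, rfl⟩ hT) fun h => hn (.raa hT h)
  have mem : ∀ β : Cl V, β.toFm ∈ Δ ↔ Provable Δ β.toFm := fun β => hΔ.mem_iff ⟨β, rfl⟩
  have neg : ∀ β : Cl V, Fm.neg β ∈ Δ ↔ β.toFm ∉ Δ := fun β => by
    refine ⟨fun h₁ h₂ => hΔ.not_provable (.negE (.hyp h₂) (.hyp h₁) _), fun h => ?_⟩
    exact (mem (.neg β)).2 (.negI hΔ.subset (hΔ.provable_insert _ ⟨β, rfl⟩ h))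
  have truth : ∀ β : Cl V, β.eval (fun p => decide (Fm.var p ∈ Δ)) = true ↔ β.toFm ∈ Δ := by
    intro β
    induction β with
    | var p => simp [Cl.eval, Cl.toFm]
    | bot => simpa [Cl.eval, Cl.toFm] using fun h => hΔ.not_provable (.hyp h)
    | top => simpa [Cl.eval] using (mem .top).2 .topI
    | neg β ih =>
      rw [Cl.toFm, neg, ← ih]
      simp [Cl.eval]
    | and β δ ihβ ihδ =>
      simp only [Cl.eval, Bool.and_eq_true, ihβ, ihδ, mem]
      exact ⟨fun h => h.1.andI h.2, fun h => ⟨h.andE₁, h.andE₂⟩⟩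
    | or β δ ihβ ihδ =>
      simp only [Cl.eval, Bool.or_eq_true, ihβ, ihδ]
      constructor
      · rintro (h | h)
        · exact (mem (.or β δ)).2 (Provable.orI₁ (.hyp h) _)
        · exact (mem (.or β δ)).2 (Provable.orI₂ (.hyp h) _)
      · intro h
        by_contra! hn
        exact hΔ.not_provable (.orE hΔ.subset subset_rfl (.hyp h)
          (hΔ.provable_insert _ ⟨β, rfl⟩ hn.1) (hΔ.provable_insert _ ⟨δ, rfl⟩ hn.2))
  have hα := h _ fun β hβ => (truth β).2 (hTΔ (Set.mem_insert_of_mem _ hβ))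
  exact (neg α).1 (hTΔ (Set.mem_insert _ _)) ((truth α).1 hα)

theorem provable_singleton_of_eval {α β : Cl V}
    (h : ∀ w : V → Bool, α.eval w = true → β.eval w = true) : Provable {α.toFm} β.toFm :=
  provable_of_eval (by rintro _ rfl; exact ⟨α, rfl⟩) fun w hw => h w (hw α rfl)

/-! ### The canonical team -/

/-- Valuations with domain `N`. -/
abbrev Valuation (N : Set V) : Type u := N → Bool

/-- The team of all valuations that satisfy the classical formulas in `Δ`. -/
def canonicalTeam (Δ : Set (Fm V)) : Set (Valuation (Set.univ : Set V)) :=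
  {v | ∀ α : Cl V, α.toFm ∈ Δ → α.eval (val v) = true}

namespace IsMaxUnprov

variable {Δ : Set (Fm V)} {χ : Fm V}

theorem mem_iff_provable (h : IsMaxUnprov Set.univ χ Δ) {φ : Fm V} : φ ∈ Δ ↔ Provable Δ φ :=
  h.mem_iff trivial

theorem toFm_mem_iff (h : IsMaxUnprov Set.univ χ Δ) (α : Cl V) :
    α.toFm ∈ Δ ↔ ∀ v ∈ canonicalTeam Δ, α.eval (val v) = true := by
  refine ⟨fun hα v hv => hv α hα, fun hα => h.mem_iff_provable.2 ?_⟩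
  refine Provable.mono (provable_of_eval (T := {γ ∈ Δ | γ.IsClassical}) (fun γ hγ => hγ.2) ?_)
    fun γ hγ => hγ.1
  intro w hw
  have hval : val (N := (Set.univ : Set V)) (fun p => w p.1) = w := by
    ext p
    simp [val]
  rw [← hval]
  refine hα _ fun β hβ => ?_
  rw [hval]
  exact hw β ⟨hβ, β, rfl⟩

theorem toFm_mem_iff_sat (h : IsMaxUnprov Set.univ χ Δ) (α : Cl V) :
    α.toFm ∈ Δ ↔ α.toFm.Sat (canonicalTeam Δ) := by
  rw [h.toFm_mem_iff, Cl.toFm_sat_iff_eval]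

theorem canonicalTeam_nonempty (h : IsMaxUnprov Set.univ χ Δ) : (canonicalTeam Δ).Nonempty := by
  by_contra hn
  have : Cl.bot.toFm ∈ Δ := (h.toFm_mem_iff _).2 fun v hv => (hn ⟨v, hv⟩).elim
  exact h.not_provable (.botE (.hyp this) χ)

theorem and_mem_iff (h : IsMaxUnprov Set.univ χ Δ) {φ ψ : Fm V} :
    Fm.and φ ψ ∈ Δ ↔ φ ∈ Δ ∧ ψ ∈ Δ := by
  simp only [h.mem_iff_provable]
  exact ⟨fun h => ⟨h.andE₁, h.andE₂⟩, fun h => h.1.andI h.2⟩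

theorem andIncls_mem_iff (h : IsMaxUnprov Set.univ χ Δ) {φ : Fm V}
    {ls : List (List (Bool × Arg V))} :
    andIncls φ ls ∈ Δ ↔ φ ∈ Δ ∧ ∀ l ∈ ls, Fm.incl l ∈ Δ := by
  simp only [h.mem_iff_provable]
  exact Provable.andIncls_iff

/-- A substitute for primeness: if both alternatives failed, maximality would supply the
subderivations of `χ` for the elimination rule. -/
theorem of_or_incl_mem (h : IsMaxUnprov Set.univ χ Δ) {φ ψ : Fm V} {l : List (Bool × Arg V)}
    (hmem : Fm.or (.and φ (.incl l)) ψ ∈ Δ) : ψ ∈ Δ ∨ Fm.or φ ψ ∈ Δ ∧ Fm.incl l ∈ Δ := by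
  by_contra! hn
  refine h.not_provable (.orInclE (.hyp hmem) (h.provable_insert ψ trivial hn.1) ?_)
  by_cases hor : Fm.or φ ψ ∈ Δ
  · exact (h.provable_insert _ trivial (hn.2 hor)).mono (by grind)
  · exact (h.provable_insert _ trivial hor).mono (by grind)

theorem of_or_andIncls_mem (h : IsMaxUnprov Set.univ χ Δ) {φ ψ : Fm V}
    {ls : List (List (Bool × Arg V))} (hmem : Fm.or (andIncls φ ls) ψ ∈ Δ) :
    ψ ∈ Δ ∨ Fm.or φ ψ ∈ Δ ∧ ∀ l ∈ ls, Fm.incl l ∈ Δ := by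
  induction ls generalizing φ with
  | nil => exact .inr ⟨hmem, by simp⟩
  | cons l ls ih =>
    rcases ih (φ := .and φ (.incl l)) hmem with hψ | ⟨hor, hls⟩
    · exact .inl hψ
    · exact (h.of_or_incl_mem hor).imp_right fun h' => ⟨h'.1, List.forall_mem_cons.2 ⟨h'.2, hls⟩⟩

end IsMaxUnprov

/-- A formula that says of the positions of `x ⊆ a`, taken as variables, that their values are `x`.
The tautology in position `i₀` takes the place of the constant `⊤`. -/
def posLits (l : List (Bool × Arg V)) (i₀ : Fin l.length) : Cl (Fin l.length) :=
  (List.finRange l.length).foldr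
    (fun i β => .and (if (l.get i).1 then .var i else .neg (.var i)) β)
    (.or (.var i₀) (.neg (.var i₀)))

theorem constFree_posLits (l : List (Bool × Arg V)) (i₀ : Fin l.length) :
    (posLits l i₀).ConstFree := by
  unfold posLits
  induction List.finRange l.length with
  | nil => exact ⟨trivial, trivial⟩
  | cons i is ih =>
    refine ⟨?_, ih⟩
    split <;> trivial

theorem eval_posLits (l : List (Bool × Arg V)) (i₀ : Fin l.length) (w : Fin l.length → Bool) :
    (posLits l i₀).eval w = true ↔ ∀ i, w i = (l.get i).1 := by
  have key : ∀ is : List (Fin l.length),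
      (is.foldr (fun i β => Cl.and (if (l.get i).1 then .var i else .neg (.var i)) β)
        (.or (.var i₀) (.neg (.var i₀)))).eval w = true ↔ ∀ i ∈ is, w i = (l.get i).1 := by
    intro is
    induction is with
    | nil => simp [Cl.eval]
    | cons i is ih =>
      rw [List.foldr_cons, Cl.eval, Bool.and_eq_true, ih, List.forall_mem_cons]
      refine and_congr_left fun _ => ?_
      cases (l.get i).1 <;> simp [Cl.eval]
  exact (key (List.finRange l.length)).trans (by simp)

theorem IsMaxUnprov.incl_mem_iff {Δ : Set (Fm V)} {χ : Fm V} (h : IsMaxUnprov Set.univ χ Δ)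
    (l : List (Bool × Arg V)) :
    Fm.incl l ∈ Δ ↔ ∃ v ∈ canonicalTeam Δ, ∀ e ∈ l, e.1 = argVal v e.2 := by
  constructor
  · intro hl
    obtain ⟨v₀, hv₀⟩ := h.canonicalTeam_nonempty
    by_contra! hn
    obtain ⟨e, he, -⟩ := hn v₀ hv₀
    -- The list is nonempty, since otherwise `v₀` would be a witness vacuously. This provides the
    -- position needed by `posLits`.
    obtain ⟨i₀, -⟩ := List.get_of_mem he
    -- Without a witness, the negation of `a^x` holds on the canonical team. Compression replaces
    -- `a` by `x` and yields a contradictory formula.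
    have hneg : ((posLits l i₀).neg.subst fun i => (l.get i).2.toCl).toFm ∈ Δ := by
      rw [h.toFm_mem_iff]
      intro v hv
      obtain ⟨e, he, hne⟩ := hn v hv
      obtain ⟨i, rfl⟩ := List.get_of_mem he
      rw [Cl.eval_subst, Cl.eval, Bool.not_eq_true', ← Bool.not_eq_true, eval_posLits]
      exact fun h => hne ((h i).symm.trans (eval_toCl _ _))
    have hconst := h.mem_iff_provable.2
      (.inclCmp l (posLits l i₀).neg (constFree_posLits l i₀) (.hyp hl) (.hyp hneg))
    have := (h.toFm_mem_iff _).1 hconst v₀ hv₀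
    rw [Cl.eval_subst, Cl.eval, Bool.not_eq_true', ← Bool.not_eq_true, eval_posLits] at this
    exact this fun i => eval_constCl _ _
  · rintro ⟨v, hv, hl⟩
    -- In this excluded middle, `a^x` is replaced by `⊤ ∧ x ⊆ a`. Then `of_or_incl_mem` yields the
    -- atom, because `v` refutes the other alternative.
    have hor : (Cl.or (lits l) (.neg (lits l))).toFm ∈ Δ := by
      rw [h.toFm_mem_iff]
      intro w _
      simp [Cl.eval]
    have hlits : Provable {(lits l).toFm} (Fm.and .top (.incl l)) := by
      refine Provable.topI.andI (.incl_of_lits fun e he => ?_)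
      refine provable_singleton_of_eval fun w hw => ?_
      have hval : val (N := (Set.univ : Set V)) (fun p => w p.1) = w := by
        ext p
        simp [val]
      rw [← hval] at hw ⊢
      exact (eval_lit _ e).2 ((eval_lits _ l).1 hw e he)
    rcases h.of_or_incl_mem (h.mem_iff_provable.2 (.or_imp (.hyp hor) hlits .self)) with hneg | hin
    · have := (h.toFm_mem_iff (.neg (lits l))).1 hneg v hv
      rw [Cl.eval, Bool.not_eq_true', ← Bool.not_eq_true, eval_lits] at this
      exact (this hl).elim
    · exact hin.2

/-! ### Characteristic formulas of teams over finitely many variables -/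

/-- `p₁ … pₖ ↦ u(p₁) … u(pₖ)`, where `p₁, …, pₖ` are the elements of `M`. -/
noncomputable def diagram (M : Finset V) (u : Valuation (M : Set V)) : List (Bool × Arg V) :=
  M.toList.map fun p => (val u p, .var p)

/-- The classical formula that describes the valuations in `s`. -/
noncomputable def describe (M : Finset V) (s : Finset (Valuation (M : Set V))) : Cl V :=
  orLitsCl .bot (s.toList.map (diagram M))

/-- The formula that is true on the nonempty teams whose restriction to `M` is `s`. -/
noncomputable def charFm (M : Finset V) (s : Finset (Valuation (M : Set V))) : Fm V :=
  andIncls (describe M s).toFm (s.toList.map (diagram M))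

/-- Restriction of a total valuation to `M`. -/
def restr (M : Set V) (v : Valuation (Set.univ : Set V)) : M → Bool := fun p => v ⟨p, trivial⟩

theorem val_restr {M : Set V} (v : Valuation (Set.univ : Set V)) {p : V} (hp : p ∈ M) :
    val (restr M v) p = val v p := by
  simp [val, hp, restr]

theorem forall_diagram_iff {M : Finset V} {u : Valuation (M : Set V)}
    {v : Valuation (Set.univ : Set V)} :
    (∀ e ∈ diagram M u, e.1 = argVal v e.2) ↔ restr M v = u := by
  simp only [diagram, List.forall_mem_map, Finset.mem_toList]
  constructor
  · intro h
    ext ⟨p, hp⟩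
    have := h p hp
    simp only [val, hp, argVal, Set.mem_univ, dite_true] at this
    rw [this, restr]
  · rintro rfl p hp
    exact val_restr v hp

theorem eval_describe {M : Finset V} {s : Finset (Valuation (M : Set V))}
    {v : Valuation (Set.univ : Set V)} :
    (describe M s).eval (val v) = true ↔ restr M v ∈ s := by
  simp only [describe, eval_orLitsCl, Cl.eval, eval_lits, List.mem_map, exists_exists_and_eq_and,
    forall_diagram_iff, Finset.mem_toList, exists_eq_right', Bool.false_eq_true, false_or]

theorem Fm.sat_restr {M : Set V} {φ : Fm V} (hφ : φ.vars ⊆ M)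
    (X : Set (Valuation (Set.univ : Set V))) : φ.Sat (restr M '' X) ↔ φ.Sat X :=
  φ.sat_image (restr M) (fun v _ hp => val_restr v hp) hφ X

namespace IsMaxUnprov

variable {Δ : Set (Fm V)} {χ : Fm V} {M : Finset V}

theorem incl_diagram_mem_iff (h : IsMaxUnprov Set.univ χ Δ) {u : Valuation (M : Set V)} :
    Fm.incl (diagram M u) ∈ Δ ↔ u ∈ restr M '' canonicalTeam Δ := by
  simp only [h.incl_mem_iff, forall_diagram_iff, Set.mem_image]

/-- The classical conjunct bounds the restricted team from above by `s`, and the atoms bound it from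
below. -/
theorem charFm_mem_iff (h : IsMaxUnprov Set.univ χ Δ) {s : Finset (Valuation (M : Set V))} :
    charFm M s ∈ Δ ↔ restr M '' canonicalTeam Δ = s := by
  simp only [charFm, h.andIncls_mem_iff, h.toFm_mem_iff, eval_describe, List.forall_mem_map,
    Finset.mem_toList, h.incl_diagram_mem_iff, Set.Subset.antisymm_iff, Set.image_subset_iff]
  rfl

/-- The atoms of `s` lie in `Δ` and are distributed into the left disjunct. The literals added by
that rule already occur as disjuncts of `describe M s`, so they change nothing. -/
theorem or_charFm_mem (h : IsMaxUnprov Set.univ χ Δ) {s : Finset (Valuation (M : Set V))}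
    {ψ : Fm V} (hs : ↑s ⊆ restr M '' canonicalTeam Δ) (hor : .or (describe M s).toFm ψ ∈ Δ) :
    .or (charFm M s) ψ ∈ Δ := by
  have hdst := Provable.inclDst (s.toList.map (diagram M)) (.hyp hor) (by
    simp only [List.forall_mem_map, Finset.mem_toList]
    exact fun u hu => .hyp (h.incl_diagram_mem_iff.2 (hs hu)))
  refine h.mem_iff_provable.2 (hdst.or_imp ?_ .self)
  obtain ⟨hlits, hincl⟩ := Provable.andIncls_iff.1 (Provable.self (φ :=
    andIncls (orLits (describe M s).toFm (s.toList.map (diagram M))) (s.toList.map (diagram M))))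
  refine Provable.andIncls_iff.2 ⟨hlits.cut' ?_, hincl⟩
  rw [← toFm_orLitsCl]
  refine provable_singleton_of_eval fun w hw => ?_
  simp only [describe, eval_orLitsCl] at hw ⊢
  tauto

end IsMaxUnprov

/-- Membership in maximal theories coincides with truth on their canonical teams. -/
def Truthful (φ : Fm V) : Prop :=
  ∀ (χ : Fm V) (Δ : Set (Fm V)), IsMaxUnprov Set.univ χ Δ → (φ ∈ Δ ↔ φ.Sat (canonicalTeam Δ))

namespace Truthful

variable {φ : Fm V} {M : Finset V}

theorem charFm_provable (hφ : Truthful φ) (hM : φ.vars ⊆ M) {s : Finset (Valuation (M : Set V))}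
    (hs : φ.Sat (s : Set (Valuation (M : Set V)))) : Provable {charFm M s} φ := by
  by_contra hn
  obtain ⟨Δ, hsub, hΔ⟩ := exists_isMaxUnprov (Set.subset_univ _) hn
  rw [← hΔ.charFm_mem_iff.1 (hsub rfl), Fm.sat_restr hM, ← hφ φ Δ hΔ] at hs
  exact hΔ.not_provable (.hyp hs)

end Truthful

/-- The disjunction of a list of formulas. -/
def bigOr (L : List (Fm V)) : Fm V := L.foldr .or .bot

theorem Provable.bigOr_of_mem {Γ : Set (Fm V)} {φ : Fm V} {L : List (Fm V)} (hφ : φ ∈ L)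
    (h : Provable Γ φ) : Provable Γ (bigOr L) := by
  induction L with
  | nil => simp at hφ
  | cons ψ L ih =>
    rcases List.mem_cons.1 hφ with rfl | hφ
    · exact h.orI₁ _
    · exact (ih hφ).orI₂ _

/-- Every formula implies the disjunction of the characteristic formulas of its teams. -/
theorem Truthful.exists_normalForm {φ : Fm V} {M : Finset V} (hφ : Truthful φ)
    (hM : φ.vars ⊆ M) :
    ∃ C : List (Finset (Valuation (M : Set V))), (∀ s ∈ C, φ.Sat (s : Set (Valuation (M : Set V)))) ∧
      Provable {φ} (bigOr (C.map (charFm M))) := by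
  classical
  let C : Finset (Finset (Valuation (M : Set V))) :=
    Finset.univ.filter fun s => φ.Sat (s : Set (Valuation (M : Set V)))
  refine ⟨C.toList, by simp [C], ?_⟩
  -- In a counterexample theory, the restriction of the canonical team to `M` is one of the teams in
  -- `C`, and its characteristic formula proves the disjunction.
  by_contra hn
  obtain ⟨Δ, hsub, hΔ⟩ := exists_isMaxUnprov (Set.subset_univ _) hn
  have hsat := (hφ _ Δ hΔ).1 (hsub rfl)
  obtain ⟨s, hs⟩ := (restr (M : Set V) '' canonicalTeam Δ).toFinite.exists_finset_coe
  rw [← Fm.sat_restr hM, ← hs] at hsat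
  refine hΔ.not_provable (.bigOr_of_mem (φ := charFm M s) ?_ (.hyp (hΔ.charFm_mem_iff.2 hs.symm)))
  exact List.mem_map_of_mem (by simpa [C] using hsat)

/-- Each characteristic disjunct is either dropped, or its atoms are moved into `Δ` and only its
classical description stays. `D` collects the teams kept, and `α` is the disjunction of their
descriptions. -/
theorem IsMaxUnprov.of_or_bigOr_mem {Δ : Set (Fm V)} {χ : Fm V} {M : Finset V}
    (h : IsMaxUnprov Set.univ χ Δ) (C : List (Finset (Valuation (M : Set V)))) {ξ : Fm V}
    (hC : .or (bigOr (C.map (charFm M))) ξ ∈ Δ) :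
    ∃ D ⊆ C, (∀ s ∈ D, ↑s ⊆ restr M '' canonicalTeam Δ) ∧
      ∃ α : Cl V, .or α.toFm ξ ∈ Δ ∧
        ∀ v, α.eval (val v) = true → ∃ s ∈ D, restr M v ∈ s := by
  induction C generalizing ξ with
  | nil => exact ⟨[], by simp, by simp, .bot, hC, by simp [Cl.eval]⟩
  | cons s C ih =>
    have hassoc := h.mem_iff_provable.2 (Provable.or_assoc (.hyp hC))
    rcases h.of_or_andIncls_mem hassoc with hξ | ⟨hξ, hs⟩
    · obtain ⟨D, hDC, hD⟩ := ih hξ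
      exact ⟨D, fun t ht => List.mem_cons_of_mem _ (hDC ht), hD⟩
    · obtain ⟨D, hDC, hD, α, hα, hαD⟩ := ih (h.mem_iff_provable.2 (Provable.or_left_comm (.hyp hξ)))
      refine ⟨s :: D, List.cons_subset_cons s hDC, List.forall_mem_cons.2 ⟨fun u hu => ?_, hD⟩,
        .or (describe M s) α, ?_, fun v hv => ?_⟩
      · exact h.incl_diagram_mem_iff.1 (hs _ (List.mem_map_of_mem (Finset.mem_toList.2 hu)))
      · refine h.mem_iff_provable.2 (Provable.orE' (Provable.or_left_comm (.hyp hα)) ?_ ?_)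
        · exact (Provable.self.orI₁ _).orI₁ _
        · exact Provable.self.or_imp (Provable.self.orI₂ _) .self
      · rcases Bool.or_eq_true _ _ ▸ hv with hv | hv
        · exact ⟨s, List.mem_cons_self, eval_describe.1 hv⟩
        · obtain ⟨t, ht, hvt⟩ := hαD v hv
          exact ⟨t, List.mem_cons_of_mem _ ht, hvt⟩

/-! ### Completeness -/

theorem Cl.vars_finite (α : Cl V) : α.vars.Finite := by
  induction α <;> simp_all [Cl.vars]

theorem Fm.vars_finite (φ : Fm V) : φ.vars.Finite := by
  induction φ with
  | neg α => exact α.vars_finite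
  | incl l =>
    refine Set.Finite.of_finite_image (f := Arg.var) ?_ fun p _ q _ h => Arg.var.inj h
    refine (l.finite_toSet.image Prod.snd).subset ?_
    rintro _ ⟨p, ⟨x, hx⟩, rfl⟩
    exact ⟨_, hx, rfl⟩
  | _ => simp_all [Fm.vars]

theorem Truthful.or {φ ψ : Fm V} (hφ : Truthful φ) (hψ : Truthful ψ) : Truthful (.or φ ψ) := by
  intro χ Δ h
  obtain ⟨M, hM⟩ := (Fm.or φ ψ).vars_finite.exists_finset_coe
  have hφM : φ.vars ⊆ M := hM ▸ Set.subset_union_left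
  have hψM : ψ.vars ⊆ M := hM ▸ Set.subset_union_right
  set X := canonicalTeam Δ with hX
  constructor
  · intro hor
    obtain ⟨C₁, hC₁, hφC₁⟩ := hφ.exists_normalForm hφM
    obtain ⟨C₂, hC₂, hψC₂⟩ := hψ.exists_normalForm hψM
    have hnf := h.mem_iff_provable.2 (Provable.or_imp (.hyp hor) hφC₁ hψC₂)
    obtain ⟨D₁, hDC₁, hD₁, α, hα, hαD₁⟩ := h.of_or_bigOr_mem C₁ hnf
    obtain ⟨D₂, hDC₂, hD₂, β, hβ, hβD₂⟩ := h.of_or_bigOr_mem C₂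
      (h.mem_iff_provable.2 (Provable.or_comm (.hyp hα)))
    have sat : ∀ {θ : Fm V} {C D : List (Finset (Valuation (M : Set V)))}, θ.vars ⊆ M →
        (∀ s ∈ C, θ.Sat (s : Set (Valuation (M : Set V)))) → D ⊆ C →
        (∀ s ∈ D, ↑s ⊆ restr M '' X) → θ.Sat {v ∈ X | ∃ s ∈ D, restr M v ∈ s} := by
      intro θ C D hθ hC hDC hD
      rw [← Fm.sat_restr hθ]
      -- Every team in `D` is realized inside the restriction of `X`, so the restricted subteam is
      -- exactly their union, and union closure applies.
      have : restr (M : Set V) '' {v ∈ X | ∃ s ∈ D, restr M v ∈ s} =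
          ⋃₀ ((fun s : Finset (Valuation (M : Set V)) => (s : Set _)) '' {s | s ∈ D}) := by
        ext u
        constructor
        · rintro ⟨v, ⟨-, s, hs, hv⟩, rfl⟩
          exact ⟨s, ⟨s, hs, rfl⟩, hv⟩
        · rintro ⟨_, ⟨s, hs, rfl⟩, hu⟩
          obtain ⟨v, hv, rfl⟩ := hD s hs hu
          exact ⟨v, ⟨hv, s, hs, hu⟩, rfl⟩
      rw [this]
      refine θ.sat_sUnion _ ?_
      rintro _ ⟨s, hs, rfl⟩
      exact hC s (hDC hs)
    refine ⟨_, _, ?_, sat hφM hC₁ hDC₁ hD₁, sat hψM hC₂ hDC₂ hD₂⟩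
    ext v
    have hv : v ∈ X → β.eval (val v) = true ∨ α.eval (val v) = true := fun hv => by
      simpa [Cl.eval] using (h.toFm_mem_iff (.or β α)).1 hβ v hv
    constructor
    · intro hvX
      exact (hv hvX).symm.imp (fun h => ⟨hvX, hαD₁ v h⟩) fun h => ⟨hvX, hβD₂ v h⟩
    · rintro (hv | hv) <;> exact hv.1
  · rintro ⟨Y, Z, hYZ, hY, hZ⟩
    obtain ⟨s, hs⟩ := (restr (M : Set V) '' Y).toFinite.exists_finset_coe
    obtain ⟨t, ht⟩ := (restr (M : Set V) '' Z).toFinite.exists_finset_coe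
    rw [← Fm.sat_restr hφM, ← hs] at hY
    rw [← Fm.sat_restr hψM, ← ht] at hZ
    -- The splitting is first expressed classically. Both descriptions are then upgraded to
    -- characteristic formulas, which prove `φ` and `ψ`.
    have hdesc : (Cl.or (describe M s) (describe M t)).toFm ∈ Δ := by
      rw [h.toFm_mem_iff, ← hX, hYZ]
      intro v hv
      rw [Cl.eval, Bool.or_eq_true, eval_describe, eval_describe, ← Finset.mem_coe,
        ← Finset.mem_coe, hs, ht]
      exact hv.imp (Set.mem_image_of_mem _) (Set.mem_image_of_mem _)
    have hsX : ↑s ⊆ restr M '' X := by rw [hs, hYZ]; exact Set.image_mono Set.subset_union_left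
    have htX : ↑t ⊆ restr M '' X := by rw [ht, hYZ]; exact Set.image_mono Set.subset_union_right
    have hs' := h.mem_iff_provable.2 (Provable.or_comm (.hyp (h.or_charFm_mem hsX hdesc)))
    have ht' := Provable.or_comm (.hyp (h.or_charFm_mem htX hs'))
    exact h.mem_iff_provable.2
      (ht'.or_imp (hφ.charFm_provable hφM hY) (hψ.charFm_provable hψM hZ))

theorem truthful (φ : Fm V) : Truthful φ := by
  induction φ with
  | var p => exact fun χ Δ h => h.toFm_mem_iff_sat (.var p)
  | bot => exact fun χ Δ h => h.toFm_mem_iff_sat .bot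
  | top => exact fun χ Δ h => h.toFm_mem_iff_sat .top
  | neg α => exact fun χ Δ h => h.toFm_mem_iff_sat (.neg α)
  | and φ ψ ihφ ihψ =>
    exact fun χ Δ h => h.and_mem_iff.trans (and_congr (ihφ χ Δ h) (ihψ χ Δ h))
  | or φ ψ ihφ ihψ => exact ihφ.or ihψ
  | incl l =>
    intro χ Δ h
    rw [h.incl_mem_iff]
    constructor
    · rintro ⟨v, hv, hl⟩
      exact incl_sat_of_mem hv hl
    · intro hl
      obtain ⟨v, hv⟩ := h.canonicalTeam_nonempty
      exact hl v hv

end PInc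

theorem theorem4p15 {V : Type*} (Γ : Set (PInc.Fm V)) (φ : PInc.Fm V) :
    PInc.Entails Γ φ ↔ PInc.Provable Γ φ := by
  constructor
  · intro h
    by_contra hn
    obtain ⟨Δ, hΓ, hΔ⟩ := PInc.exists_isMaxUnprov (Set.subset_univ Γ) hn
    -- The canonical team has all variables in its domain, so it is admissible in the entailment.
    have hφ := h Set.univ (fun _ _ => Set.subset_univ _) (Set.subset_univ _)
      (PInc.canonicalTeam Δ) fun γ hγ => (PInc.truthful γ φ Δ hΔ).1 (hΓ hγ)
    exact hΔ.not_provable (.hyp ((PInc.truthful φ φ Δ hΔ).2 hφ))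
  · rintro ⟨A, hA, h⟩ N _ _ X hX
    exact h.sound X fun γ hγ => hX γ (hA hγ)
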